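/- There exist a finite set $P$ of points in convex position in the Euclidean plane (no point of $P$ lies in the convex hull of the other points of $P$) and a Delaunay triangulation $T$ of $P$ whose dilation is at least $1.5810$. Here a Delaunay triangulation of $P$ is a triangulation of the convex hull of $P$ with vertex set $P$ such that the circumcircle of every triangle has no point of $P$ in its interior; further points of $P$ may lie on the circumcircle, so that $P$ may have several Delaunay triangulations. The dilation of $T$ is $$\max_{p,p'\in P,\ p\neq p'} \frac{d_T(p,p')}{\|pp'\|},$$ where $d_T(p,p')$ is the length of a shortest path from $p$ to $p'$ along edges of $T$, each edge being weighted by its Euclidean length. -/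

import Mathlib

open scoped ENNReal

noncomputable section

namespace DelaunayDilation

/-- The Euclidean plane. -/
abbrev Plane : Type := EuclideanSpace ℝ (Fin 2)

/-- Every point of `P` is a vertex of the convex hull of `P`: no point of `P` lies in the
convex hull of the others. -/
def InConvexPosition (P : Finset Plane) : Prop :=
  ConvexIndependent ℝ (fun p : P => (p : Plane))

/-- `K` is a triangulation of (the convex hull of) `P`: a geometric simplicial complex whose
vertices are exactly the points of `P` and which fills the convex hull of `P`. -/
structure IsTriangulation (P : Finset Plane) (K : Geometry.SimplicialComplex ℝ Plane) : Prop where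
  vertices_eq : K.vertices = (P : Set Plane)
  space_eq : K.space = convexHull ℝ (P : Set Plane)

/-- A Delaunay triangulation of `P`: a triangulation such that the circumcircle of every triangle
has no point of `P` in its interior. Further points of `P` may lie on the circumcircle, so a
Delaunay triangulation need not be unique. -/
structure IsDelaunayTriangulation (P : Finset Plane)
    (K : Geometry.SimplicialComplex ℝ Plane) : Prop extends IsTriangulation P K where
  empty_circumcircle : ∀ t ∈ K.faces, t.card = 3 →
    ∀ C : EuclideanGeometry.Sphere Plane, (∀ v ∈ t, v ∈ C) →
      ∀ p ∈ P, C.radius ≤ dist p C.center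

/-- The graph on `P` formed by the edges (one-dimensional faces) of `K`. -/
def edgeGraph (P : Finset Plane) (K : Geometry.SimplicialComplex ℝ Plane) : SimpleGraph P where
  Adj p q := p ≠ q ∧ ∃ e ∈ K.faces, (e : Set Plane) = {(p : Plane), (q : Plane)}
  symm := ⟨fun _ _ h => ⟨h.1.symm, h.2.imp fun _ he => ⟨he.1, he.2.trans (Set.pair_comm _ _)⟩⟩⟩
  loopless := ⟨fun _ h => h.1 rfl⟩

/-- The Euclidean length of a walk: the sum of the lengths of its edges. -/
def walkLength {P : Finset Plane} {G : SimpleGraph P} {p q : P} (w : G.Walk p q) : ℝ≥0∞ :=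
  (w.darts.map fun e => edist e.fst e.snd).sum

/-- The length of a shortest path from `p` to `q` in the Euclidean graph `G`. -/
def pathDist {P : Finset Plane} (G : SimpleGraph P) (p q : P) : ℝ≥0∞ :=
  ⨅ w : G.Walk p q, walkLength w

/-- The dilation of the Euclidean graph `G`: the maximum, over all pairs of distinct vertices,
of the shortest path length divided by the Euclidean distance. -/
def dilation {P : Finset Plane} (G : SimpleGraph P) : ℝ≥0∞ :=
  ⨆ (p : P) (q : P) (_ : p ≠ q), pathDist G p q / edist p q

end DelaunayDilation

end

/-! Cut the unit disk along its horizontal diameter and move the two halves a distance `g` apart.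
The points of `P` are spread evenly over the two half-circles of the resulting stadium. The points
on one half are cocircular, so every triangulation of their hull is Delaunay, and the rectangle
between the halves is cocircular as well. Triangulate the upper half by a zigzag around a point `p`,
followed by a fan, and the lower half antipodally. Let `h v` be the distance from `p` to `v` along
the boundary. Every edge `u v` satisfies `|h u - h v| ≤ dist u v`, so a path from `p` to its
antipode is at least as long as half of the perimeter, about `π + g`. If `p` lies in direction `φ`,
its antipode is at distance `√(4 + 4 g sin φ + g²)`, which calls for a small `φ`. The last edge of
the fan is nearly a diameter, so the fan can cover an arc of length at most `2`, and this forces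
`φ ≥ π / 2 - 1`. With `φ` close to this bound, `g = 0.3` nearly maximises the ratio. -/

namespace DelaunayDilation

open Geometry Real

theorem affineIndependent_insert {k E : Type*} [DivisionRing k] [AddCommGroup E] [Module k E]
    {s : Set E} {c : E} (hs : AffineIndependent k ((↑) : s → E)) (hc : c ∉ affineSpan k s) :
    AffineIndependent k ((↑) : ↥(insert c s) → E) := by
  have hrest : {x : ↥(insert c s) | x ≠ ⟨c, Set.mem_insert c s⟩} = (↑) ⁻¹' s := by
    ext ⟨x, hx⟩
    have hcs : c ∉ s := fun h => hc (subset_affineSpan k s h)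
    grind
  refine AffineIndependent.affineIndependent_of_notMem_span (i := ⟨c, Set.mem_insert c s⟩) ?_ ?_
  · exact hs.comp_embedding ⟨fun x => ⟨x.1, hrest.subset x.2⟩, fun x y h =>
      Subtype.ext (Subtype.ext (Subtype.mk.inj h))⟩
  · rw [hrest]
    simpa using fun h => hc (affineSpan_mono k Set.inter_subset_right h)

theorem eq_zero_of_mem_affineSpan {k E : Type*} [Ring k] [AddCommGroup E] [Module k E]
    {f : E →ᵃ[k] k} {s : Set E} (hs : ∀ y ∈ s, f y = 0) {x : E} (hx : x ∈ affineSpan k s) :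
    f x = 0 := by
  have hfx : f x ∈ affineSpan k (f '' s) := AffineSubspace.map_span f s ▸ ⟨x, hx, rfl⟩
  have hfs : f '' s ⊆ {0} := Set.image_subset_iff.2 hs
  simpa using affineSpan_mono k hfs hfx

section Attach

variable {𝕜 E : Type*} [Field 𝕜] [LinearOrder 𝕜] [IsStrictOrderedRing 𝕜] [AddCommGroup E]
  [Module 𝕜 E]

theorem segment_subset_union {a b w : E} (hw : w ∈ segment 𝕜 a b) :
    segment 𝕜 a b ⊆ segment 𝕜 a w ∪ segment 𝕜 w b := by
  have hline : w ∈ Set.range (AffineMap.lineMap a b : 𝕜 → E) :=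
    Set.image_subset_range _ _ (segment_eq_image_lineMap 𝕜 a b ▸ hw)
  rw [← insert_endpoints_openSegment]
  refine Set.insert_subset (Or.inl (left_mem_segment 𝕜 a w))
    (Set.insert_subset (Or.inr (right_mem_segment 𝕜 w b))
      ((openSegment_subset_union a b hline).trans
        (Set.insert_subset (Or.inl (right_mem_segment 𝕜 a w)) ?_)))
  exact Set.union_subset_union (openSegment_subset_segment 𝕜 a w)
    (openSegment_subset_segment 𝕜 w b)

variable {f : E →ᵃ[𝕜] 𝕜} {P s : Set E} {c x : E}

theorem nonpos_of_mem_convexHull (hP : ∀ y ∈ P, f y ≤ 0) (hx : x ∈ convexHull 𝕜 P) : f x ≤ 0 :=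
  convexHull_min (t := f ⁻¹' Set.Iic 0) hP ((convex_Iic 0).affine_preimage f) hx

theorem nonneg_of_mem_convexHull (hP : ∀ y ∈ P, 0 ≤ f y) (hx : x ∈ convexHull 𝕜 P) : 0 ≤ f x :=
  convexHull_min (t := f ⁻¹' Set.Ici 0) hP ((convex_Ici 0).affine_preimage f) hx

theorem mem_convexHull_of_mem_convexHull_insert (hs : ∀ y ∈ s, f y = 0) (hc : 0 < f c)
    (hx : x ∈ convexHull 𝕜 (insert c s)) (hfx : f x = 0) : x ∈ convexHull 𝕜 s := by
  rcases s.eq_empty_or_nonempty with rfl | hne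
  · simp_all
  rw [convexHull_insert hne, convexJoin_singleton_left] at hx
  obtain ⟨z, hz, r, t, -, -, hrt, rfl⟩ := Set.mem_iUnion₂.1 hx
  have hfz : f z = 0 := eq_zero_of_mem_affineSpan hs (convexHull_subset_affineSpan s hz)
  rw [Convex.combo_affine_apply hrt, hfz, smul_zero, add_zero, smul_eq_mul] at hfx
  obtain rfl : r = 0 := (mul_eq_zero.1 hfx).resolve_right hc.ne'
  obtain rfl : t = 1 := by simpa using hrt
  simpa using hz

theorem convexHull_insert_eq_union (hsP : s ⊆ P) (hP : ∀ y ∈ P, f y ≤ 0) (hc : 0 < f c)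
    (hcross : ∀ y ∈ convexHull 𝕜 (insert c P), f y = 0 → y ∈ convexHull 𝕜 s) :
    convexHull 𝕜 (insert c P) = convexHull 𝕜 P ∪ convexHull 𝕜 (insert c s) := by
  refine Set.Subset.antisymm (fun y hy => ?_) (Set.union_subset
    (convexHull_mono (Set.subset_insert c P)) (convexHull_mono (Set.insert_subset_insert hsP)))
  rcases P.eq_empty_or_nonempty with rfl | hne
  · exact Or.inr (convexHull_mono (Set.insert_subset_insert (Set.empty_subset s)) hy)
  rw [convexHull_insert hne, convexJoin_singleton_left] at hy
  obtain ⟨z, hz, hyz⟩ := Set.mem_iUnion₂.1 hy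
  obtain ⟨w, hw, hfw⟩ : (0 : 𝕜) ∈ f '' segment 𝕜 c z := by
    rw [image_segment, segment_eq_uIcc]
    exact Set.mem_uIcc.2 (Or.inr ⟨nonpos_of_mem_convexHull hP hz, hc.le⟩)
  have hws : w ∈ convexHull 𝕜 s :=
    hcross w ((convex_convexHull 𝕜 _).segment_subset (subset_convexHull 𝕜 _ (Set.mem_insert c P))
      (convexHull_mono (Set.subset_insert c P) hz) hw) hfw
  rcases segment_subset_union hw hyz with hy | hy
  · exact Or.inr ((convex_convexHull 𝕜 _).segment_subset
      (subset_convexHull 𝕜 _ (Set.mem_insert c s)) (convexHull_mono (Set.subset_insert c s) hws) hy)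
  · exact Or.inl ((convex_convexHull 𝕜 P).segment_subset (convexHull_mono hsP hws) hz hy)

variable {s t u : Finset E}

/-- The complex of all faces of the simplex with vertex set `s`. -/
def fullSimplex (s : Finset E) (hs : AffineIndependent 𝕜 ((↑) : s → E)) :
    SimplicialComplex 𝕜 E where
  faces := {u | u.Nonempty ∧ u ⊆ s}
  isRelLowerSet_faces := fun _ hu => ⟨hu.1, fun _ ht hne => ⟨hne, ht.trans hu.2⟩⟩
  indep := fun hu => hs.mono (Finset.coe_subset.2 hu.2)
  inter_subset_convexHull := fun hu ht => by
    classical exact (hs.convexHull_inter hu.2 ht.2).ge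

section fullSimplex

variable {hs : AffineIndependent 𝕜 ((↑) : s → E)}

theorem mem_fullSimplex_faces : u ∈ (fullSimplex s hs).faces ↔ u.Nonempty ∧ u ⊆ s := Iff.rfl

theorem vertices_fullSimplex : (fullSimplex s hs).vertices = s := by
  ext x
  simp [SimplicialComplex.mem_vertices, mem_fullSimplex_faces]

theorem space_fullSimplex : (fullSimplex s hs).space = convexHull 𝕜 (s : Set E) := by
  refine Set.Subset.antisymm (fun x hx => ?_) (fun x hx => ?_)
  · obtain ⟨u, ⟨-, hu⟩, hxu⟩ := SimplicialComplex.mem_space_iff.1 hx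
    exact convexHull_mono (Finset.coe_subset.2 hu) hxu
  · have hne : s.Nonempty := Finset.coe_nonempty.1 (convexHull_nonempty_iff.1 ⟨x, hx⟩)
    exact SimplicialComplex.mem_space_iff.2 ⟨s, ⟨hne, subset_rfl⟩, hx⟩

end fullSimplex

variable [DecidableEq E] {K : SimplicialComplex 𝕜 E}

theorem convexHull_inter_subset_of_subset_insert (hs : s ∈ K.faces) (hfs : ∀ y ∈ s, f y = 0)
    (hfK : ∀ y ∈ K.vertices, f y ≤ 0) (hfc : 0 < f c) (hcu : c ∈ u) (hu : u ⊆ insert c s)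
    (ht : t ∈ K.faces) :
    convexHull 𝕜 (u : Set E) ∩ convexHull 𝕜 t ⊆ convexHull 𝕜 (u ∩ t : Set E) := by
  rintro y ⟨hyu, hyt⟩
  have herase : u.erase c ⊆ s := Finset.subset_insert_iff.1 hu
  have hle : f y ≤ 0 := by
    refine nonpos_of_mem_convexHull (fun x hx => hfK x ?_) hyt
    exact K.down_closed ht (by simpa using hx) (Finset.singleton_nonempty x)
  have hge : 0 ≤ f y := by
    refine nonneg_of_mem_convexHull (fun x hx => ?_) hyu
    rcases Finset.mem_insert.1 (hu hx) with rfl | hxs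
    exacts [hfc.le, (hfs x hxs).ge]
  have hy : y ∈ convexHull 𝕜 (u.erase c : Set E) := by
    refine mem_convexHull_of_mem_convexHull_insert (fun x hx => hfs x (herase hx)) hfc ?_
      (hle.antisymm hge)
    rwa [← Finset.coe_insert, Finset.insert_erase hcu]
  have hne : (u.erase c).Nonempty := Finset.coe_nonempty.1 (convexHull_nonempty_iff.1 ⟨y, hy⟩)
  refine convexHull_mono (Set.inter_subset_inter_left _ ?_)
    (K.inter_subset_convexHull (K.down_closed hs herase hne) ht ⟨hy, hyt⟩)
  exact_mod_cast Finset.erase_subset c u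

/-- The complex obtained from `K` by erecting on its face `s` a simplex with apex `c`. The affine
functional `f` certifies that the new simplex meets `K` only along `s`. -/
def attachSimplex (K : SimplicialComplex 𝕜 E) (f : E →ᵃ[𝕜] 𝕜) (s : Finset E) (c : E)
    (hs : s ∈ K.faces) (hfs : ∀ y ∈ s, f y = 0) (hfK : ∀ y ∈ K.vertices, f y ≤ 0)
    (hfc : 0 < f c) : SimplicialComplex 𝕜 E where
  faces := K.faces ∪ {u | c ∈ u ∧ u ⊆ insert c s}
  isRelLowerSet_faces := by
    rintro u (hu | ⟨hcu, hu⟩)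
    · exact ⟨K.nonempty_of_mem_faces hu, fun t ht hne => Or.inl (K.down_closed hu ht hne)⟩
    · refine ⟨⟨c, hcu⟩, fun t ht hne => ?_⟩
      by_cases hct : c ∈ t
      · exact Or.inr ⟨hct, ht.trans hu⟩
      · have hts : t ⊆ s := (Finset.subset_insert_iff_of_notMem hct).1 (ht.trans hu)
        exact Or.inl (K.down_closed hs hts hne)
  indep := by
    rintro u (hu | ⟨-, hu⟩)
    · exact K.indep hu
    · have hc : c ∉ affineSpan 𝕜 (s : Set E) := fun h => hfc.ne' (eq_zero_of_mem_affineSpan hfs h)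
      exact (affineIndependent_insert (K.indep hs) hc).mono (by exact_mod_cast hu)
  inter_subset_convexHull := by
    have hc : c ∉ affineSpan 𝕜 (s : Set E) := fun h => hfc.ne' (eq_zero_of_mem_affineSpan hfs h)
    rintro u t (hu | ⟨hcu, hu⟩) (ht | ⟨hct, ht⟩)
    · exact K.inter_subset_convexHull hu ht
    · rw [Set.inter_comm, Set.inter_comm (u : Set E)]
      exact convexHull_inter_subset_of_subset_insert hs hfs hfK hfc hct ht hu
    · exact convexHull_inter_subset_of_subset_insert hs hfs hfK hfc hcu hu ht
    · have hind : AffineIndependent 𝕜 ((↑) : ↥(insert c s) → E) :=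
        (affineIndependent_insert (K.indep hs) hc).mono (by simp)
      exact (hind.convexHull_inter hu ht).ge

section attachSimplex

variable {hs : s ∈ K.faces} {hfs : ∀ y ∈ s, f y = 0} {hfK : ∀ y ∈ K.vertices, f y ≤ 0}
  {hfc : 0 < f c}

theorem mem_attachSimplex_faces :
    u ∈ (attachSimplex K f s c hs hfs hfK hfc).faces ↔ u ∈ K.faces ∨ c ∈ u ∧ u ⊆ insert c s :=
  Iff.rfl

theorem vertices_attachSimplex :
    (attachSimplex K f s c hs hfs hfK hfc).vertices = insert c K.vertices := by
  ext x
  simp only [SimplicialComplex.mem_vertices, mem_attachSimplex_faces, Set.mem_insert_iff,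
    Finset.mem_singleton]
  constructor
  · rintro (h | ⟨rfl, -⟩)
    exacts [Or.inr h, Or.inl rfl]
  · rintro (rfl | h)
    exacts [Or.inr ⟨rfl, by simp⟩, Or.inl h]

theorem space_attachSimplex :
    (attachSimplex K f s c hs hfs hfK hfc).space =
      K.space ∪ convexHull 𝕜 (insert c (s : Set E)) := by
  ext x
  simp only [SimplicialComplex.mem_space_iff, mem_attachSimplex_faces, Set.mem_union,
    ← Finset.coe_insert]
  constructor
  · rintro ⟨u, hu | ⟨-, hu⟩, hxu⟩
    exacts [Or.inl ⟨u, hu, hxu⟩, Or.inr (convexHull_mono (Finset.coe_subset.2 hu) hxu)]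
  · rintro (⟨u, hu, hxu⟩ | hx)
    exacts [⟨u, Or.inl hu, hxu⟩, ⟨_, Or.inr ⟨Finset.mem_insert_self c s, subset_rfl⟩, hx⟩]

end attachSimplex

end Attach

/-- Twice the signed area of the triangle `a b c`, as an affine function of `c`. -/
noncomputable def orient (a b : Plane) : Plane →ᵃ[ℝ] ℝ where
  toFun c := (b 0 - a 0) * (c 1 - a 1) - (b 1 - a 1) * (c 0 - a 0)
  linear := (b 0 - a 0) • EuclideanSpace.projₗ 1 - (b 1 - a 1) • EuclideanSpace.projₗ 0
  map_vadd' c v := by simp; ring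

theorem orient_apply (a b c : Plane) :
    orient a b c = (b 0 - a 0) * (c 1 - a 1) - (b 1 - a 1) * (c 0 - a 0) := rfl

theorem orient_rotate (a b c : Plane) : orient b c a = orient a b c := by
  simp only [orient_apply]; ring

theorem orient_swap (a b c : Plane) : orient a c b = -orient a b c := by
  simp only [orient_apply]; ring

@[simp] theorem orient_self_left (a b : Plane) : orient a b a = 0 := by
  simp only [orient_apply]; ring

@[simp] theorem orient_self_right (a b : Plane) : orient a b b = 0 := by
  simp only [orient_apply]; ring

@[simp] theorem orient_self_self (a b : Plane) : orient a a b = 0 := by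
  simp only [orient_apply]; ring

theorem orient_add_orient_add_orient (a b c x : Plane) :
    orient b c x + orient c a x + orient a b x = orient a b c := by
  simp only [orient_apply]; ring

theorem orient_smul_add_orient_smul_add_orient_smul (a b c x : Plane) :
    orient b c x • a + orient c a x • b + orient a b x • c = orient a b c • x := by
  ext i
  fin_cases i <;>
    simp only [orient_apply, PiLp.add_apply, PiLp.smul_apply, smul_eq_mul, Fin.zero_eta,
      Fin.mk_one, Fin.isValue] <;> ring

theorem mem_convexHull_pair {a b c x : Plane} (h : 0 < orient a b c) (hx : orient a b x = 0)
    (hbc : 0 ≤ orient b c x) (hca : 0 ≤ orient c a x) : x ∈ convexHull ℝ {a, b} := by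
  have hsum := orient_add_orient_add_orient a b c x
  have hbary := orient_smul_add_orient_smul_add_orient_smul a b c x
  rw [hx, add_zero] at hsum
  rw [hx, zero_smul, add_zero] at hbary
  rw [convexHull_pair]
  refine ⟨(orient a b c)⁻¹ * orient b c x, (orient a b c)⁻¹ * orient c a x, by positivity,
    by positivity, by rw [← mul_add, hsum, inv_mul_cancel₀ h.ne'], ?_⟩
  rw [mul_smul, mul_smul, ← smul_add, hbary, inv_smul_smul₀ h.ne']

section Polygon

variable {P : Finset Plane} {K : SimplicialComplex ℝ Plane}

theorem exists_isTriangulation_pair {a b : Plane} (hab : a ≠ b) :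
    ∃ K : SimplicialComplex ℝ Plane, IsTriangulation {a, b} K ∧
      ∀ u, u ∈ K.faces ↔ u.Nonempty ∧ u ⊆ {a, b} := by
  have hind : AffineIndependent ℝ ((↑) : ({a, b} : Finset Plane) → Plane) := by
    refine ((affineIndependent_of_ne ℝ hab).range).mono ?_
    simp [Matrix.range_cons, Set.insert_subset_iff]
  exact ⟨fullSimplex _ hind, ⟨vertices_fullSimplex, space_fullSimplex⟩, fun u => Iff.rfl⟩

theorem IsTriangulation.exists_attach (hK : IsTriangulation P K) {a b c : Plane}
    (hab : {a, b} ∈ K.faces) (habc : 0 < orient a b c) (hP : ∀ x ∈ P, orient a b x ≤ 0)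
    (hbc : ∀ x ∈ P, 0 ≤ orient b c x) (hca : ∀ x ∈ P, 0 ≤ orient c a x) :
    ∃ L : SimplicialComplex ℝ Plane, IsTriangulation (insert c P) L ∧
      ∀ u, u ∈ L.faces ↔ u ∈ K.faces ∨ c ∈ u ∧ u ⊆ {c, a, b} := by
  have hzero : ∀ y ∈ ({a, b} : Finset Plane), orient a b y = 0 := by simp
  have habP : ((({a, b} : Finset Plane)) : Set Plane) ⊆ P := by
    rw [← hK.vertices_eq, SimplicialComplex.vertices_eq]
    exact Set.subset_biUnion_of_mem (u := fun k : Finset Plane => (k : Set Plane)) hab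
  have hcross : ∀ y ∈ convexHull ℝ (insert c (P : Set Plane)), orient a b y = 0 →
      y ∈ convexHull ℝ (({a, b} : Finset Plane) : Set Plane) := fun y hy hy0 => by
    rw [Finset.coe_pair]
    refine mem_convexHull_pair habc hy0 (nonneg_of_mem_convexHull ?_ hy)
      (nonneg_of_mem_convexHull ?_ hy) <;> simpa
  refine ⟨attachSimplex K (orient a b) {a, b} c hab hzero (hK.vertices_eq ▸ hP) habc,
    ⟨?_, ?_⟩, fun u => Iff.rfl⟩
  · rw [vertices_attachSimplex, hK.vertices_eq, Finset.coe_insert]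
  · rw [space_attachSimplex, hK.space_eq, Finset.coe_insert c P,
      convexHull_insert_eq_union habP hP habc hcross]

/-- The sequence `z` runs counterclockwise, and periodically, through the `n` vertices of a
strictly convex polygon. -/
structure IsConvexPolygon (z : ℤ → Plane) (n : ℤ) : Prop where
  periodic : Function.Periodic z n
  orient_pos : ∀ {i j k}, i < j → j < k → k < i + n → 0 < orient (z i) (z j) (z k)

namespace IsConvexPolygon

variable {z : ℤ → Plane} {n i j k l u : ℤ}

theorem orient_nonneg (hz : IsConvexPolygon z n) (hij : i ≤ j) (hjk : j ≤ k) (hk : k < i + n) :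
    0 ≤ orient (z i) (z j) (z k) := by
  rcases hij.eq_or_lt with rfl | hij
  · simp
  rcases hjk.eq_or_lt with rfl | hjk
  · simp
  exact (hz.orient_pos hij hjk hk).le

theorem exists_separating (hz : IsConvexPolygon z n) (hn : 3 ≤ n) (k : ℤ) :
    ∃ f : Plane →ᵃ[ℝ] ℝ, f (z k) < 0 ∧ ∀ j, k < j → j < k + n → 0 ≤ f (z j) := by
  refine ⟨orient (z (k + n - 1)) (z (k + 1)), ?_, fun j hj hjn => ?_⟩
  · rw [orient_swap, ← orient_rotate, neg_lt_zero]
    exact hz.orient_pos (by lia) (by lia) (by lia)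
  · rw [← orient_rotate]
    exact hz.orient_nonneg (by lia) (by lia) (by lia)

theorem ne (hz : IsConvexPolygon z n) (hn : 3 ≤ n) (hij : i < j) (hj : j < i + n) :
    z i ≠ z j := by
  obtain ⟨f, hi, hf⟩ := hz.exists_separating hn i
  exact fun h => (hf j hij hj).not_gt (h ▸ hi)

theorem injOn_Icc (hz : IsConvexPolygon z n) (hn : 3 ≤ n) (hu : u < l + n) :
    Set.InjOn z (Set.Icc l u) := by
  intro i hi j hj h
  by_contra hij
  rcases lt_or_gt_of_ne hij with hij | hij
  · exact hz.ne hn hij (by grind) h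
  · exact hz.ne hn hij (by grind) h.symm

theorem inConvexPosition (hz : IsConvexPolygon z n) (hn : 3 ≤ n) (hu : u < l + n) :
    InConvexPosition ((Finset.Icc l u).image z) := by
  refine convexIndependent_set_iff_notMem_convexHull_sdiff.2 fun x hx hxP => ?_
  obtain ⟨k, hk, rfl⟩ := Finset.mem_image.1 hx
  obtain ⟨f, hfk, hf⟩ := hz.exists_separating hn k
  refine hfk.not_ge (nonneg_of_mem_convexHull (fun y hy => ?_) hxP)
  obtain ⟨j, hj, rfl⟩ := Finset.mem_image.1 hy.1
  have hjk : j ≠ k := fun h => hy.2 (h ▸ rfl)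
  rw [Finset.mem_Icc] at hj hk
  rcases lt_or_gt_of_ne hjk with hjk | hjk
  · rw [← hz.periodic j]
    exact hf _ (by lia) (by lia)
  · exact hf j hjk (by lia)

theorem exists_attach_left (hz : IsConvexPolygon z n) (hlu : l + 1 < u) (hu : u < l + n)
    {K : SimplicialComplex ℝ Plane} (hK : IsTriangulation ((Finset.Icc (l + 1) u).image z) K)
    (he : {z (l + 1), z u} ∈ K.faces) :
    ∃ L : SimplicialComplex ℝ Plane, IsTriangulation ((Finset.Icc l u).image z) L ∧
      ∀ t, t ∈ L.faces ↔ t ∈ K.faces ∨ z l ∈ t ∧ t ⊆ {z l, z (l + 1), z u} := by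
  rw [← Finset.insert_Icc_add_one_left_eq_Icc (by lia), Finset.image_insert]
  refine hK.exists_attach he ?_ ?_ ?_ ?_
  · rw [orient_rotate]
    exact hz.orient_pos (by lia) hlu hu
  all_goals
    simp only [Finset.forall_mem_image, Finset.mem_Icc]
    rintro j ⟨hlj, hju⟩
  · rw [orient_swap, neg_nonpos]
    exact hz.orient_nonneg hlj hju (by lia)
  · rw [orient_rotate, orient_rotate]
    exact hz.orient_nonneg (by lia) hju hu
  · exact hz.orient_nonneg (by lia) hlj (by lia)

theorem exists_attach_right (hz : IsConvexPolygon z n) (hlu : l < u - 1) (hu : u < l + n)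
    {K : SimplicialComplex ℝ Plane} (hK : IsTriangulation ((Finset.Icc l (u - 1)).image z) K)
    (he : {z l, z (u - 1)} ∈ K.faces) :
    ∃ L : SimplicialComplex ℝ Plane, IsTriangulation ((Finset.Icc l u).image z) L ∧
      ∀ t, t ∈ L.faces ↔ t ∈ K.faces ∨ z u ∈ t ∧ t ⊆ {z u, z l, z (u - 1)} := by
  rw [← Finset.insert_Icc_sub_one_right_eq_Icc (by lia), Finset.image_insert]
  refine hK.exists_attach he ?_ ?_ ?_ ?_
  · exact hz.orient_pos hlu (by lia) hu
  all_goals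
    simp only [Finset.forall_mem_image, Finset.mem_Icc]
    rintro j ⟨hlj, hju⟩
  · rw [orient_swap, neg_nonpos]
    exact hz.orient_nonneg hlj hju (by lia)
  · rw [orient_rotate]
    exact hz.orient_nonneg hju (by lia) (by lia)
  · rw [orient_rotate, orient_rotate]
    exact hz.orient_nonneg hlj (by lia) hu

end IsConvexPolygon

/-- A ladder in a polygon with `n` vertices: a set `D` of pairs of indices, each of which is an edge
`i (i + 1)` or arises from another pair by moving one end by one vertex. -/
structure IsLadder (D : ℤ → ℤ → Prop) (n : ℤ) : Prop where
  lt : ∀ {l u}, D l u → l < u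
  lt_add : ∀ {l u}, D l u → u < l + n
  predecessor : ∀ {l u}, D l u → u = l + 1 ∨ D (l + 1) u ∨ D l (u - 1)

/-- The vertices `i ≤ j ≤ k` span the triangle between the pair `i k` of the ladder `D` and the
pair `j k` or `i j` it arises from; the case `j = k` covers the edge at the end of the ladder. -/
structure IsLadderTriangle (D : ℤ → ℤ → Prop) (i j k : ℤ) : Prop where
  outer : D i k
  inner : j = i + 1 ∧ (D j k ∨ j = k) ∨ k = j + 1 ∧ D i j

namespace IsLadderTriangle

variable {D : ℤ → ℤ → Prop} {n i j k : ℤ}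

theorem le_left (hT : IsLadderTriangle D i j k) (hD : IsLadder D n) : i ≤ j := by
  rcases hT.inner with ⟨rfl, -⟩ | ⟨-, h⟩
  exacts [by lia, (hD.lt h).le]

theorem le_right (hT : IsLadderTriangle D i j k) (hD : IsLadder D n) : j ≤ k := by
  rcases hT.inner with ⟨-, h | rfl⟩ | ⟨rfl, -⟩
  exacts [(hD.lt h).le, le_rfl, by lia]

theorem pairwise (hT : IsLadderTriangle D i j k) (hD : IsLadder D n) {S : ℤ → ℤ → Prop}
    (hrefl : ∀ a, S a a) (hsymm : ∀ a b, S a b → S b a) (hdiag : ∀ a b, D a b → S a b)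
    (hedge : ∀ a, i ≤ a → a < k → S a (a + 1)) {a b : ℤ} (ha : a = i ∨ a = j ∨ a = k)
    (hb : b = i ∨ b = j ∨ b = k) : S a b := by
  have hik := hdiag i k hT.outer
  have hlt := hD.lt hT.outer
  have hij : S i j := by
    rcases hT.inner with ⟨rfl, -⟩ | ⟨-, h⟩
    exacts [hedge i le_rfl hlt, hdiag i j h]
  have hjk : S j k := by
    rcases hT.inner with ⟨-, h | rfl⟩ | ⟨rfl, h⟩
    exacts [hdiag j k h, hrefl j, hedge j (hD.lt h).le (lt_add_one j)]
  rcases ha with rfl | rfl | rfl <;> rcases hb with rfl | rfl | rfl <;>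
    first | exact hrefl _ | assumption | exact hsymm _ _ ‹_›

end IsLadderTriangle

theorem IsLadder.exists_isTriangulation {D : ℤ → ℤ → Prop} {n : ℤ} (hD : IsLadder D n)
    {z : ℤ → Plane} (hz : IsConvexPolygon z n) (hn : 3 ≤ n) {l u : ℤ} (hlu : D l u) :
    ∃ K : SimplicialComplex ℝ Plane, IsTriangulation ((Finset.Icc l u).image z) K ∧
      {z l, z u} ∈ K.faces ∧
      ∀ t ∈ K.faces, ∃ i j k, l ≤ i ∧ k ≤ u ∧ IsLadderTriangle D i j k ∧ t ⊆ {z i, z j, z k} := by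
  induction h : (u - l).toNat generalizing l u with
  | zero => have := hD.lt hlu; lia
  | succ m ih =>
    have hu := hD.lt_add hlu
    rcases hD.predecessor hlu with rfl | hin | hin
    · obtain ⟨K, hK, hfaces⟩ := exists_isTriangulation_pair (hz.ne hn (by lia) hu)
      rw [← Finset.insert_Icc_add_one_left_eq_Icc (by lia), Finset.Icc_self, Finset.image_insert,
        Finset.image_singleton]
      refine ⟨K, hK, (hfaces _).2 ⟨by simp, subset_rfl⟩, fun t ht =>
        ⟨l, l + 1, l + 1, le_rfl, le_rfl, ⟨hlu, by simp⟩, by simpa using ((hfaces t).1 ht).2⟩⟩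
    · obtain ⟨K, hK, he, hfaces⟩ := ih hin (by lia)
      obtain ⟨L, hL, hLfaces⟩ := hz.exists_attach_left (hD.lt hin) hu hK he
      refine ⟨L, hL, (hLfaces _).2 (Or.inr ⟨by simp, by grind⟩), fun t ht => ?_⟩
      rcases (hLfaces t).1 ht with ht | ⟨-, ht⟩
      · obtain ⟨i, j, k, hi, hk, h⟩ := hfaces t ht
        exact ⟨i, j, k, by lia, hk, h⟩
      · exact ⟨l, l + 1, u, le_rfl, le_rfl, ⟨hlu, Or.inl ⟨rfl, Or.inl hin⟩⟩, ht⟩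
    · obtain ⟨K, hK, he, hfaces⟩ := ih hin (by lia)
      obtain ⟨L, hL, hLfaces⟩ := hz.exists_attach_right (hD.lt hin) hu hK he
      refine ⟨L, hL, (hLfaces _).2 (Or.inr ⟨by simp, by grind⟩), fun t ht => ?_⟩
      rcases (hLfaces t).1 ht with ht | ⟨-, ht⟩
      · obtain ⟨i, j, k, hi, hk, h⟩ := hfaces t ht
        exact ⟨i, j, k, hi, by lia, h⟩
      · exact ⟨l, u - 1, u, le_rfl, le_rfl, ⟨hlu, Or.inr ⟨by lia, hin⟩⟩, ht.trans (by grind)⟩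

theorem IsTriangulation.isDelaunayTriangulation (hK : IsTriangulation P K)
    (h : ∀ t ∈ K.faces, ∃ S : EuclideanGeometry.Sphere Plane, (∀ v ∈ t, v ∈ S) ∧
      ∀ p ∈ P, S.radius ≤ dist p S.center) : IsDelaunayTriangulation P K := by
  refine ⟨hK, fun t ht hcard C hC => ?_⟩
  obtain ⟨S, hS, hP⟩ := h t ht
  suffices C = S by rwa [this]
  by_contra hne
  obtain ⟨a, b, c, hab, hac, hbc, rfl⟩ := Finset.card_eq_three.1 hcard
  have := EuclideanGeometry.eq_of_mem_sphere_of_mem_sphere_of_finrank_eq_two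
    (by simp) hne hab (hC a (by simp)) (hC b (by simp)) (hC c (by simp))
    (hS a (by simp)) (hS b (by simp)) (hS c (by simp))
  rcases this with rfl | rfl
  · exact hac rfl
  · exact hbc rfl

theorem ofReal_sub_le_walkLength {G : SimpleGraph P} {f : P → ℝ}
    (hf : ∀ x y, G.Adj x y → f y - f x ≤ dist x y) {p q : P} (w : G.Walk p q) :
    ENNReal.ofReal (f q - f p) ≤ walkLength w := by
  induction w with
  | nil => simp
  | @cons x y q hxy w ih =>
    have : walkLength (SimpleGraph.Walk.cons hxy w) = edist x y + walkLength w := by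
      simp [walkLength]
    rw [this, edist_dist]
    calc ENNReal.ofReal (f q - f x) = ENNReal.ofReal ((f y - f x) + (f q - f y)) := by congr 1; ring
      _ ≤ ENNReal.ofReal (f y - f x) + ENNReal.ofReal (f q - f y) := ENNReal.ofReal_add_le
      _ ≤ _ := by gcongr; exact hf x y hxy

theorem ofReal_le_dilation {G : SimpleGraph P} {f : P → ℝ}
    (hf : ∀ x y, G.Adj x y → f y - f x ≤ dist x y) {p q : P} (hpq : p ≠ q) {r : ℝ} (hr : 0 ≤ r)
    (h : r * dist p q ≤ f q - f p) : ENNReal.ofReal r ≤ dilation G := by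
  refine le_trans ?_ (le_iSup₂_of_le p q (le_iSup_of_le hpq le_rfl))
  rw [ENNReal.le_div_iff_mul_le (Or.inl (edist_pos.2 hpq).ne') (Or.inl (edist_ne_top _ _)),
    edist_dist, ← ENNReal.ofReal_mul hr]
  exact le_iInf fun w => (ENNReal.ofReal_le_ofReal h).trans (ofReal_sub_le_walkLength hf w)

theorem IsLadder.exists_le_dilation {D : ℤ → ℤ → Prop} {n : ℤ} (hD : IsLadder D n)
    {z : ℤ → Plane} (hz : IsConvexPolygon z n) (hn : 3 ≤ n) {l u : ℤ} (hlu : D l u)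
    (hcircle : ∀ i j k, IsLadderTriangle D i j k → ∃ S : EuclideanGeometry.Sphere Plane,
      z i ∈ S ∧ z j ∈ S ∧ z k ∈ S ∧ ∀ m, S.radius ≤ dist (z m) S.center)
    {h : ℤ → ℝ} (hedge : ∀ i, l ≤ i → i < u → |h i - h (i + 1)| ≤ dist (z i) (z (i + 1)))
    (hdiag : ∀ i k, D i k → |h i - h k| ≤ dist (z i) (z k))
    {p q : ℤ} (hp : p ∈ Finset.Icc l u) (hq : q ∈ Finset.Icc l u) (hpq : p ≠ q) {r : ℝ}
    (hr : 0 ≤ r) (hrpq : r * dist (z p) (z q) ≤ h q - h p) :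
    ∃ (P : Finset Plane) (K : SimplicialComplex ℝ Plane), InConvexPosition P ∧
      IsDelaunayTriangulation P K ∧ ENNReal.ofReal r ≤ dilation (edgeGraph P K) := by
  obtain ⟨K, hK, -, hfaces⟩ := hD.exists_isTriangulation hz hn hlu
  have hinj := hz.injOn_Icc hn (hD.lt_add hlu)
  let f : Plane → ℝ := h ∘ Function.invFunOn z (Set.Icc l u)
  have hf : ∀ i, l ≤ i → i ≤ u → f (z i) = h i := fun i hi hi' =>
    congrArg h (hinj.leftInvOn_invFunOn ⟨hi, hi'⟩)
  refine ⟨_, K, hz.inConvexPosition hn (hD.lt_add hlu), hK.isDelaunayTriangulation fun t ht => ?_,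
    ofReal_le_dilation (f := fun x => f x) (p := ⟨z p, Finset.mem_image_of_mem z hp⟩)
      (q := ⟨z q, Finset.mem_image_of_mem z hq⟩) ?_ ?_ hr ?_⟩
  · obtain ⟨i, j, k, -, -, hT, ht⟩ := hfaces t ht
    obtain ⟨S, hi, hj, hk, hS⟩ := hcircle i j k hT
    refine ⟨S, fun v hv => ?_, Finset.forall_mem_image.2 fun m _ => hS m⟩
    have := ht hv
    simp only [Finset.mem_insert, Finset.mem_singleton] at this
    rcases this with rfl | rfl | rfl <;> assumption
  · rintro x y ⟨-, e, he, hxy⟩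
    obtain ⟨i, j, k, hi, hk, hT, hsub⟩ := hfaces e he
    have hvertex : ∀ v ∈ e, ∃ m, (m = i ∨ m = j ∨ m = k) ∧ z m = v ∧ f v = h m := fun v hv => by
      have := hsub hv
      simp only [Finset.mem_insert, Finset.mem_singleton] at this
      have hij := hT.le_left hD
      have hjk := hT.le_right hD
      rcases this with rfl | rfl | rfl
      exacts [⟨i, by simp, rfl, hf i hi (by lia)⟩, ⟨j, by simp, rfl, hf j (by lia) (by lia)⟩,
        ⟨k, by simp, rfl, hf k (by lia) hk⟩]
    obtain ⟨a, ha, hax, hfa⟩ := hvertex x (by rw [← Finset.mem_coe, hxy]; simp)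
    obtain ⟨b, hb, hby, hfb⟩ := hvertex y (by rw [← Finset.mem_coe, hxy]; simp)
    have hab : |h b - h a| ≤ dist (z b) (z a) :=
      hT.pairwise hD (S := fun a b => |h a - h b| ≤ dist (z a) (z b)) (by simp)
        (fun a b hab => by rwa [abs_sub_comm, dist_comm]) hdiag
        (fun m hm hmk => hedge m (by lia) (by lia)) hb ha
    rw [hfa, hfb, Subtype.dist_eq, ← hax, ← hby, dist_comm]
    exact (le_abs_self _).trans hab
  · exact fun h => hpq (hinj (by simpa using hp) (by simpa using hq) (congrArg Subtype.val h))
  · rw [Finset.mem_Icc] at hp hq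
    simpa only [hf p hp.1 hp.2, hf q hq.1 hq.2, Subtype.dist_eq] using hrpq

end Polygon

theorem dist_sq_eq (x y : Plane) : dist x y ^ 2 = (x 0 - y 0) ^ 2 + (x 1 - y 1) ^ 2 := by
  rw [EuclideanSpace.dist_eq, sq_sqrt (by positivity), Fin.sum_univ_two, Real.dist_eq,
    Real.dist_eq, sq_abs, sq_abs]

theorem cos_lt_cos_of_sin_pos {x y z : ℝ} (hxy : x < y) (hyz : y < z) (hz : z < x + 2 * π)
    (hx : 0 < sin x) (hy : 0 < sin y) (hsz : sin z < 0) : cos y < cos x := by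
  have hclose : y - x ≤ π := by
    by_contra! hfar
    have hyx : sin (y - x) < 0 := by
      rw [← sin_sub_two_pi]
      exact sin_neg_of_neg_of_neg_pi_lt (by linarith) (by linarith)
    have hzx : sin (z - x) < 0 := by
      rw [← sin_sub_two_pi]
      exact sin_neg_of_neg_of_neg_pi_lt (by linarith) (by linarith)
    have hzy : 0 < sin (z - y) := sin_pos_of_pos_of_lt_pi (by linarith) (by linarith)
    have hsin : sin z * sin (y - x) = sin y * sin (z - x) - sin x * sin (z - y) := by
      simp only [sin_sub]; ring
    nlinarith
  have hcos : 0 ≤ cos ((x - y) / 2) :=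
    cos_nonneg_of_neg_pi_div_two_le_of_le (by linarith) (by linarith)
  have hmid : 0 < sin ((x + y) / 2) := by
    have : 0 < 2 * sin ((x + y) / 2) * cos ((x - y) / 2) := by
      rw [← sin_add_sin]; linarith
    linarith [pos_of_mul_pos_left this hcos]
  have hhalf : sin ((x - y) / 2) < 0 :=
    sin_neg_of_neg_of_neg_pi_lt (by linarith) (by linarith [pi_pos])
  rw [← sub_pos, cos_sub_cos]
  nlinarith

theorem cos_lt_cos_of_sin_neg {x y z : ℝ} (hxy : x < y) (hyz : y < z) (hz : z < x + 2 * π)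
    (hx : sin x < 0) (hy : sin y < 0) (hsz : 0 < sin z) : cos x < cos y := by
  have := cos_lt_cos_of_sin_pos (x := x + π) (y := y + π) (z := z + π) (by linarith) (by linarith)
    (by linarith) (by simpa) (by simpa) (by simpa)
  simpa using this

/-- The boundary point in direction `φ` of the stadium formed by two halves of the unit disk, cut
along its horizontal diameter and moved a distance `g` apart. The point `(1, 0)` of direction `0`
lies on neither half. -/
noncomputable def stadiumPoint (g φ : ℝ) : Plane :=
  !₂[cos φ, sin φ + g / 2 * sign (sin φ)]

section StadiumPoint

variable {g φ ψ α β γ : ℝ}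

theorem stadiumPoint_add_pi (g φ : ℝ) : stadiumPoint g (φ + π) = -stadiumPoint g φ := by
  ext i
  fin_cases i
  · simp [stadiumPoint]
  · simp [stadiumPoint, Real.sign_neg]; ring

theorem sign_eq_or_eq_neg (hφ : sin φ ≠ 0) (hψ : sin ψ ≠ 0) :
    sign (sin ψ) = sign (sin φ) ∨ sign (sin ψ) = -sign (sin φ) := by
  rcases sign_apply_eq_of_ne_zero _ hφ with h | h <;>
    rcases sign_apply_eq_of_ne_zero _ hψ with h' | h' <;> simp [h, h']

theorem norm_stadiumPoint_sq (g : ℝ) (hφ : sin φ ≠ 0) :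
    ‖stadiumPoint g φ‖ ^ 2 = 1 + g * |sin φ| + g ^ 2 / 4 := by
  rw [← dist_zero_right, dist_sq_eq]
  rcases hφ.lt_or_gt with h | h
  · simp only [stadiumPoint, PiLp.zero_apply, PiLp.toLp_apply, Matrix.cons_val_zero,
      Matrix.cons_val_one, sign_of_neg h, abs_of_neg h]
    linear_combination sin_sq_add_cos_sq φ
  · simp only [stadiumPoint, PiLp.zero_apply, PiLp.toLp_apply, Matrix.cons_val_zero,
      Matrix.cons_val_one, sign_of_pos h, abs_of_pos h]
    linear_combination sin_sq_add_cos_sq φ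

theorem dist_stadiumPoint_of_sign_eq (g : ℝ) (h : sign (sin φ) = sign (sin ψ)) :
    dist (stadiumPoint g φ) (stadiumPoint g ψ) = 2 * |sin ((φ - ψ) / 2)| := by
  refine (sq_eq_sq₀ dist_nonneg (by positivity)).1 ?_
  rw [dist_sq_eq, mul_pow, sq_abs]
  simp only [stadiumPoint, Matrix.cons_val_zero, Matrix.cons_val_one, h]
  have hcos : cos (φ - ψ) = 1 - 2 * sin ((φ - ψ) / 2) ^ 2 := by
    rw [← mul_div_cancel₀ (φ - ψ) two_ne_zero, cos_two_mul, cos_sq']; ring_nf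
  rw [cos_sub] at hcos
  linear_combination sin_sq_add_cos_sq φ + sin_sq_add_cos_sq ψ - 2 * hcos

theorem orient_circle_pos (hαβ : α < β) (hβγ : β < γ) (hγ : γ < α + 2 * π) :
    0 < (cos β - cos α) * (sin γ - sin α) - (sin β - sin α) * (cos γ - cos α) := by
  have hβα : 0 < sin ((β - α) / 2) := sin_pos_of_pos_of_lt_pi (by linarith) (by linarith)
  have hγβ : 0 < sin ((γ - β) / 2) := sin_pos_of_pos_of_lt_pi (by linarith) (by linarith)
  have hγα : 0 < sin ((γ - α) / 2) := sin_pos_of_pos_of_lt_pi (by linarith) (by linarith)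
  have : (cos β - cos α) * (sin γ - sin α) - (sin β - sin α) * (cos γ - cos α) =
      4 * sin ((β - α) / 2) * sin ((γ - β) / 2) * sin ((γ - α) / 2) := by
    rw [cos_sub_cos, cos_sub_cos, sin_sub_sin, sin_sub_sin,
      show (γ - β) / 2 = (γ + α) / 2 - (β + α) / 2 by ring, sin_sub]
    ring
  rw [this]
  positivity

theorem sum_sign_mul_cos_sub_cos_nonneg (hαβ : α < β) (hβγ : β < γ) (hγ : γ < α + 2 * π)
    (hα : sin α ≠ 0) (hβ : sin β ≠ 0) (hγ' : sin γ ≠ 0) :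
    0 ≤ sign (sin α) * (cos γ - cos β) + sign (sin β) * (cos α - cos γ) +
      sign (sin γ) * (cos β - cos α) := by
  have hcosα := cos_add_two_pi α
  rw [← sin_add_two_pi] at hα hβ
  rcases hα.lt_or_gt with hα | hα <;> rcases hβ.lt_or_gt with hβ | hβ <;>
    rcases hγ'.lt_or_gt with hγ' | hγ' <;>
    have hα' := hα <;> have hβ' := hβ <;> rw [sin_add_two_pi] at hα' hβ' <;>
    simp only [sign_of_pos, sign_of_neg, hα', hβ', hγ']
  · linarith
  · linarith [cos_lt_cos_of_sin_neg hαβ hβγ hγ hα' hβ' hγ']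
  · linarith [cos_lt_cos_of_sin_neg hγ (by linarith) (by linarith) hγ' hα hβ]
  · linarith [cos_lt_cos_of_sin_pos hβγ hγ (by linarith) hβ' hγ' hα]
  · linarith [cos_lt_cos_of_sin_neg hβγ hγ (by linarith) hβ' hγ' hα]
  · linarith [cos_lt_cos_of_sin_pos hγ (by linarith) (by linarith) hγ' hα hβ]
  · linarith [cos_lt_cos_of_sin_pos hαβ hβγ hγ hα' hβ' hγ']
  · linarith

theorem orient_stadiumPoint_pos (hg : 0 ≤ g) (hαβ : α < β) (hβγ : β < γ) (hγ : γ < α + 2 * π)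
    (hα : sin α ≠ 0) (hβ : sin β ≠ 0) (hγ' : sin γ ≠ 0) :
    0 < orient (stadiumPoint g α) (stadiumPoint g β) (stadiumPoint g γ) := by
  have hcircle := orient_circle_pos hαβ hβγ hγ
  have hsign := mul_nonneg (by positivity : 0 ≤ g / 2)
    (sum_sign_mul_cos_sub_cos_nonneg hαβ hβγ hγ hα hβ hγ')
  simp only [orient_apply, stadiumPoint, Matrix.cons_val_zero, Matrix.cons_val_one]
  linarith

/-- The circle through all points on the same half of the stadium as the point in direction `φ`. -/
noncomputable def halfCircle (g φ : ℝ) : EuclideanGeometry.Sphere Plane :=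
  ⟨!₂[0, g / 2 * sign (sin φ)], 1⟩

theorem stadiumPoint_mem_halfCircle (g : ℝ) (h : sign (sin ψ) = sign (sin φ)) :
    stadiumPoint g ψ ∈ halfCircle g φ := by
  refine (sq_eq_sq₀ dist_nonneg zero_le_one).1 ?_
  rw [dist_sq_eq]
  simp [halfCircle, stadiumPoint, h]

theorem radius_halfCircle_le_dist (hg : 0 ≤ g) (hφ : sin φ ≠ 0) (hψ : sin ψ ≠ 0) :
    (halfCircle g φ).radius ≤ dist (stadiumPoint g ψ) (halfCircle g φ).center := by
  rcases sign_eq_or_eq_neg hφ hψ with h | h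
  · exact (EuclideanGeometry.mem_sphere.1 (stadiumPoint_mem_halfCircle g h)).ge
  · refine (sq_le_sq₀ zero_le_one dist_nonneg).1 ?_
    rw [dist_sq_eq]
    have habs : 0 ≤ g * (sign (sin ψ) * sin ψ) := mul_nonneg hg (sign_mul_nonneg _)
    have hsq : sign (sin ψ) ^ 2 = 1 := by
      rcases sign_apply_eq_of_ne_zero _ hψ with h | h <;> simp [h]
    simp only [halfCircle, stadiumPoint, Matrix.cons_val_zero, Matrix.cons_val_one,
      ← neg_eq_iff_eq_neg.2 h]
    nlinarith [sin_sq_add_cos_sq ψ, sq_nonneg g, hsq]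

end StadiumPoint

/-- The direction of vertex `i` of the regular `2 * N`-gon with a side bisected by direction `0`. -/
noncomputable def vertexAngle (N i : ℤ) : ℝ := (2 * i + 1) * (π / (2 * N))

/-- The vertices of the stadium polygon: the vertices `0, …, N - 1` lie on the upper half and the
vertices `N, …, 2 * N - 1` on the lower one. -/
noncomputable def stadiumVertex (g : ℝ) (N i : ℤ) : Plane := stadiumPoint g (vertexAngle N i)

section StadiumVertex

variable {g : ℝ} {N i j k : ℤ}

theorem vertexAngle_add (hN : 0 < N) (i : ℤ) : vertexAngle N (i + N) = vertexAngle N i + π := by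
  have : (N : ℝ) ≠ 0 := by exact_mod_cast hN.ne'
  simp only [vertexAngle]
  push_cast
  field_simp
  ring

theorem vertexAngle_strictMono (hN : 0 < N) : StrictMono (vertexAngle N) := by
  intro i j hij
  have : (0 : ℝ) < N := by exact_mod_cast hN
  have : (i : ℝ) < j := by exact_mod_cast hij
  simp only [vertexAngle]
  gcongr

theorem sin_le_sin_int_mul (hk : 1 ≤ k) (hkN : k < 2 * N) :
    sin (π / (2 * N)) ≤ sin (k * (π / (2 * N))) := by
  have hN : (0 : ℝ) < N := by exact_mod_cast (by lia : 0 < N)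
  have hk1 : (1 : ℝ) ≤ k := by exact_mod_cast hk
  have hk2 : (k : ℝ) + 1 ≤ 2 * N := by exact_mod_cast hkN
  have hπ : π / (2 * N) * N = π / 2 := by field_simp
  have hh : 0 < π / (2 * N) := by positivity
  rw [← cos_pi_div_two_sub, ← cos_pi_div_two_sub (k * _), ← cos_abs (_ - k * _)]
  refine cos_le_cos_of_nonneg_of_le_pi (abs_nonneg _) (by linarith [pi_pos]) (abs_le.2 ⟨?_, ?_⟩) <;>
    nlinarith

theorem sin_pi_div_two_mul_pos (hN : 0 < N) : 0 < sin (π / (2 * N)) := by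
  have : (1 : ℝ) ≤ N := by exact_mod_cast hN
  refine sin_pos_of_pos_of_lt_pi (by positivity) (div_lt_self pi_pos (by linarith))

theorem sin_le_sin_vertexAngle (hi : 0 ≤ i) (hiN : i < N) :
    sin (π / (2 * N)) ≤ sin (vertexAngle N i) := by
  simpa [vertexAngle] using sin_le_sin_int_mul (k := 2 * i + 1) (N := N) (by lia) (by lia)

theorem sin_vertexAngle_pos (hi : 0 ≤ i) (hiN : i < N) : 0 < sin (vertexAngle N i) :=
  (sin_pi_div_two_mul_pos (by lia)).trans_le (sin_le_sin_vertexAngle hi hiN)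

theorem sin_vertexAngle_add (hN : 0 < N) (i : ℤ) :
    sin (vertexAngle N (i + N)) = -sin (vertexAngle N i) := by
  rw [vertexAngle_add hN, sin_add_pi]

theorem sin_le_abs_sin_vertexAngle (hN : 0 < N) (i : ℤ) :
    sin (π / (2 * N)) ≤ |sin (vertexAngle N i)| := by
  have hper : Function.Periodic (fun i => |sin (vertexAngle N i)|) N := fun i => by
    simp [sin_vertexAngle_add hN]
  have hmod : |sin (vertexAngle N (i % N))| = |sin (vertexAngle N i)| := by
    rw [Int.emod_def, mul_comm]
    exact hper.sub_int_mul_eq (i / N)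
  rw [← hmod]
  exact (sin_le_sin_vertexAngle (i.emod_nonneg hN.ne') (i.emod_lt_of_pos hN)).trans (le_abs_self _)

theorem sin_vertexAngle_ne_zero (hN : 0 < N) (i : ℤ) : sin (vertexAngle N i) ≠ 0 :=
  abs_pos.1 ((sin_pi_div_two_mul_pos hN).trans_le (sin_le_abs_sin_vertexAngle hN i))

theorem antiperiodic_stadiumVertex (hN : 0 < N) : (stadiumVertex g N).Antiperiodic N := fun i => by
  rw [stadiumVertex, vertexAngle_add hN, stadiumPoint_add_pi, stadiumVertex]

theorem isConvexPolygon_stadiumVertex (hg : 0 ≤ g) (hN : 0 < N) :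
    IsConvexPolygon (stadiumVertex g N) (2 * N) where
  periodic := (antiperiodic_stadiumVertex hN).periodic_two_mul
  orient_pos {i j k} hij hjk hk := by
    have hmono := vertexAngle_strictMono hN
    refine orient_stadiumPoint_pos hg (hmono hij) (hmono hjk) ?_ (sin_vertexAngle_ne_zero hN i)
      (sin_vertexAngle_ne_zero hN j) (sin_vertexAngle_ne_zero hN k)
    calc vertexAngle N k < vertexAngle N (i + N + N) := hmono (by lia)
      _ = vertexAngle N i + 2 * π := by rw [vertexAngle_add hN, vertexAngle_add hN]; ring

/-- The half of the stadium containing vertex `i`: `1` for the upper half, `-1` for the lower. -/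
noncomputable def vertexSign (N i : ℤ) : ℝ := sign (sin (vertexAngle N i))

theorem vertexSign_eq_one (hi : 0 ≤ i) (hiN : i < N) : vertexSign N i = 1 :=
  sign_of_pos (sin_vertexAngle_pos hi hiN)

theorem antiperiodic_vertexSign (hN : 0 < N) : (vertexSign N).Antiperiodic N := fun i => by
  rw [vertexSign, sin_vertexAngle_add hN, Real.sign_neg, vertexSign]

theorem vertexSign_eq_neg_one (hi : -N ≤ i ∧ i < 0 ∨ N ≤ i ∧ i < 2 * N) :
    vertexSign N i = -1 := by
  have hper := antiperiodic_vertexSign (N := N) (by lia)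
  rcases hi with hi | hi
  · rw [← neg_eq_iff_eq_neg, ← hper i, vertexSign_eq_one (by lia) (by lia)]
  · rw [← neg_eq_iff_eq_neg, ← hper.sub_eq i, vertexSign_eq_one (by lia) (by lia)]

theorem dist_stadiumVertex (g : ℝ) (h : vertexSign N i = vertexSign N j) :
    dist (stadiumVertex g N i) (stadiumVertex g N j) = 2 * |sin ((i - j) * (π / (2 * N)))| := by
  rw [stadiumVertex, stadiumVertex, dist_stadiumPoint_of_sign_eq g h]
  simp only [vertexAngle]
  ring_nf

theorem dist_stadiumVertex_antipode (g : ℝ) (hN : 0 < N) (i : ℤ) :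
    dist (stadiumVertex g N i) (stadiumVertex g N (i + N)) = 2 * ‖stadiumVertex g N i‖ := by
  rw [antiperiodic_stadiumVertex hN, dist_eq_norm, sub_neg_eq_add, ← two_smul ℝ, norm_smul,
    Real.norm_two]

theorem vertexAngle_zero (N : ℤ) : vertexAngle N 0 = π / (2 * N) := by
  simp [vertexAngle]

theorem vertexAngle_neg_one (N : ℤ) : vertexAngle N (-1) = -(π / (2 * N)) := by
  norm_num [vertexAngle]

theorem dist_stadiumVertex_neg_one_zero (hg : 0 ≤ g) (hN : 0 < N) :
    dist (stadiumVertex g N (-1)) (stadiumVertex g N 0) = 2 * sin (π / (2 * N)) + g := by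
  have hsin := sin_pi_div_two_mul_pos hN
  rw [← sq_eq_sq₀ dist_nonneg (by positivity), dist_sq_eq]
  simp only [stadiumVertex, stadiumPoint, vertexAngle_zero, vertexAngle_neg_one, cos_neg, sin_neg,
    Real.sign_neg, sign_of_pos hsin, Matrix.cons_val_zero, Matrix.cons_val_one]
  ring

theorem abs_sin_vertexAngle_of_corner (hN : 0 < N) (hi : i ∈ ({-1, 0, N - 1, N} : Finset ℤ)) :
    |sin (vertexAngle N i)| = sin (π / (2 * N)) := by
  have hsin := sin_pi_div_two_mul_pos hN
  have hzero : |sin (vertexAngle N 0)| = sin (π / (2 * N)) := by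
    rw [vertexAngle_zero, abs_of_pos hsin]
  have hneg : |sin (vertexAngle N (-1))| = sin (π / (2 * N)) := by
    rw [vertexAngle_neg_one, sin_neg, abs_neg, abs_of_pos hsin]
  have hshift := sin_vertexAngle_add hN
  simp only [Finset.mem_insert, Finset.mem_singleton] at hi
  rcases hi with rfl | rfl | rfl | rfl
  · exact hneg
  · exact hzero
  · rw [sub_eq_neg_add, hshift, abs_neg, hneg]
  · simpa only [hzero, abs_neg, zero_add] using congrArg abs (hshift 0)

theorem norm_stadiumVertex_sq (g : ℝ) (hN : 0 < N) (i : ℤ) :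
    ‖stadiumVertex g N i‖ ^ 2 = 1 + g * |sin (vertexAngle N i)| + g ^ 2 / 4 :=
  norm_stadiumPoint_sq g (sin_vertexAngle_ne_zero hN i)

theorem exists_sphere_of_vertexSign_eq (hg : 0 ≤ g) (hN : 0 < N)
    (hij : vertexSign N i = vertexSign N j) (hik : vertexSign N i = vertexSign N k) :
    ∃ S : EuclideanGeometry.Sphere Plane, stadiumVertex g N i ∈ S ∧ stadiumVertex g N j ∈ S ∧
      stadiumVertex g N k ∈ S ∧ ∀ m, S.radius ≤ dist (stadiumVertex g N m) S.center :=
  ⟨halfCircle g (vertexAngle N i), stadiumPoint_mem_halfCircle g rfl,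
    stadiumPoint_mem_halfCircle g hij.symm, stadiumPoint_mem_halfCircle g hik.symm,
    fun m => radius_halfCircle_le_dist hg (sin_vertexAngle_ne_zero hN i)
      (sin_vertexAngle_ne_zero hN m)⟩

theorem exists_sphere_of_corner (hg : 0 ≤ g) (hN : 0 < N)
    (hi : i ∈ ({-1, 0, N - 1, N} : Finset ℤ)) (hj : j ∈ ({-1, 0, N - 1, N} : Finset ℤ))
    (hk : k ∈ ({-1, 0, N - 1, N} : Finset ℤ)) :
    ∃ S : EuclideanGeometry.Sphere Plane, stadiumVertex g N i ∈ S ∧ stadiumVertex g N j ∈ S ∧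
      stadiumVertex g N k ∈ S ∧ ∀ m, S.radius ≤ dist (stadiumVertex g N m) S.center := by
  have hcorner : ∀ m ∈ ({-1, 0, N - 1, N} : Finset ℤ),
      ‖stadiumVertex g N m‖ = ‖stadiumVertex g N 0‖ := fun m hm => by
    rw [← sq_eq_sq₀ (norm_nonneg _) (norm_nonneg _), norm_stadiumVertex_sq g hN,
      norm_stadiumVertex_sq g hN, abs_sin_vertexAngle_of_corner hN hm,
      abs_sin_vertexAngle_of_corner hN (by simp)]
  refine ⟨⟨0, ‖stadiumVertex g N 0‖⟩, ?_, ?_, ?_, fun m => ?_⟩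
  · simpa [EuclideanGeometry.mem_sphere] using hcorner i hi
  · simpa [EuclideanGeometry.mem_sphere] using hcorner j hj
  · simpa [EuclideanGeometry.mem_sphere] using hcorner k hk
  · rw [dist_zero_right, ← sq_le_sq₀ (norm_nonneg _) (norm_nonneg _), norm_stadiumVertex_sq g hN,
      norm_stadiumVertex_sq g hN, abs_sin_vertexAngle_of_corner hN (by simp)]
    gcongr
    exact sin_le_abs_sin_vertexAngle hN m

end StadiumVertex

section Diagonals

/-- The diagonals of the triangulation of the upper half: a zigzag around the edge `p (p + 1)` until
vertex `0` is reached, then a fan from vertex `0`. -/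
def IsUpperDiagonal (N p l u : ℤ) : Prop :=
  0 ≤ l ∧ l < u ∧ u < N ∧ (l + u = 2 * p ∨ l + u = 2 * p + 1 ∨ l = 0 ∧ 2 * p ≤ u)

/-- The diagonals of the triangulation of the stadium polygon: the diagonals of the upper half,
their antipodes and one diagonal of the rectangle between the two halves. -/
def IsDiagonal (N p l u : ℤ) : Prop :=
  IsUpperDiagonal N p l u ∨ l = -1 ∧ u = N - 1 ∨ IsUpperDiagonal N p (u - N) (l + N)

variable {N p i j k l u : ℤ}

theorem isLadder_isDiagonal (hp : 0 ≤ p) (hpN : 2 * p + 1 ≤ N) (hN : 2 ≤ N) :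
    IsLadder (IsDiagonal N p) (2 * N) where
  lt h := by unfold IsDiagonal IsUpperDiagonal at h; lia
  lt_add h := by unfold IsDiagonal IsUpperDiagonal at h; lia
  predecessor h := by
    unfold IsDiagonal IsUpperDiagonal at *
    rcases h with ⟨h0, hlu, hu, h | h | ⟨rfl, h⟩⟩ | ⟨rfl, rfl⟩ | ⟨h0, hlu, hu, h | h | ⟨hl, h⟩⟩ <;>
      omega

theorem isDiagonal_final (hp : 0 ≤ p) (hpN : 2 * p + 1 ≤ N) (hN : 2 ≤ N) :
    IsDiagonal N p (p + 1 - N) (p + N) := by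
  unfold IsDiagonal IsUpperDiagonal; lia

theorem IsLadderTriangle.half_or_corner (hp : 0 ≤ p) (hpN : 2 * p + 1 ≤ N) (hN : 2 ≤ N)
    (hT : IsLadderTriangle (IsDiagonal N p) i j k) :
    (0 ≤ i ∧ i ≤ j ∧ j ≤ k ∧ k < N) ∨
    (∀ m, m = i ∨ m = j ∨ m = k → -N ≤ m ∧ m < 0 ∨ N ≤ m ∧ m < 2 * N) ∨
    (∀ m, m = i ∨ m = j ∨ m = k → m = -1 ∨ m = 0 ∨ m = N - 1 ∨ m = N) := by
  have hD := isLadder_isDiagonal hp hpN hN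
  have := hT.le_left hD
  have := hT.le_right hD
  have hin := hT.inner
  rcases hT.outer with ⟨h0, -, hu, -⟩ | ⟨rfl, rfl⟩ | h
  · exact Or.inl (by lia)
  · refine Or.inr (Or.inr ?_)
    unfold IsDiagonal IsUpperDiagonal at hin
    omega
  · unfold IsDiagonal IsUpperDiagonal at *
    by_cases hj : j = N - 1
    · exact Or.inr (Or.inr (by omega))
    · exact Or.inr (Or.inl (by omega))

end Diagonals

section Shortness

/-- The distance from vertex `p` of the upper half to vertex `i` along the boundary of the stadium
polygon, for `i` within `N` of `p`. -/
noncomputable def boundaryDist (g : ℝ) (N p i : ℤ) : ℝ :=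
  |(i : ℝ) - p| * (2 * sin (π / (2 * N))) + g / 2 * (1 - vertexSign N i)

/-- Vertices `i` and `j` differ in boundary distance from `p` by at most their Euclidean
distance. -/
def IsShort (g : ℝ) (N p i j : ℤ) : Prop :=
  |boundaryDist g N p i - boundaryDist g N p j| ≤ dist (stadiumVertex g N i) (stadiumVertex g N j)

variable {g : ℝ} {N p i j k l u : ℤ}

theorem boundaryDist_self (hp : 0 ≤ p) (hpN : p < N) : boundaryDist g N p p = 0 := by
  simp [boundaryDist, vertexSign_eq_one hp hpN]

theorem boundaryDist_add_boundaryDist (hN : 0 < N) (hi : p - N ≤ i) (hip : i ≤ p) :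
    boundaryDist g N p i + boundaryDist g N p (i + N) = N * (2 * sin (π / (2 * N))) + g := by
  have hi' : (p : ℝ) - N ≤ i := by exact_mod_cast hi
  have hip' : (i : ℝ) ≤ p := by exact_mod_cast hip
  simp only [boundaryDist]
  push_cast
  rw [antiperiodic_vertexSign hN, abs_of_nonpos (by linarith), abs_of_nonneg (by linarith)]
  ring

theorem IsShort.antipode (h : IsShort g N p (u - N) (l + N)) (hN : 0 < N) (hl : p - N ≤ l)
    (hlp : l ≤ p) (hu : p ≤ u) (hup : u ≤ p + N) : IsShort g N p l u := by
  have hl := boundaryDist_add_boundaryDist (g := g) hN hl hlp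
  have hu := boundaryDist_add_boundaryDist (g := g) hN (by lia : p - N ≤ u - N) (by lia)
  have hz := antiperiodic_stadiumVertex (g := g) hN
  rw [IsShort, hz l, hz.sub_eq u, dist_neg_neg, dist_comm] at h
  rw [sub_add_cancel] at hu
  rw [IsShort]
  convert h using 2
  linarith

theorem isShort_of_vertexSign_eq (h : vertexSign N i = vertexSign N j)
    (hij : |(|(i : ℝ) - p| - |(j : ℝ) - p|)| * sin (π / (2 * N)) ≤
      |sin ((i - j) * (π / (2 * N)))|) (hN : 0 < N) : IsShort g N p i j := by
  have hdiff : boundaryDist g N p i - boundaryDist g N p j =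
      2 * ((|(i : ℝ) - p| - |(j : ℝ) - p|) * sin (π / (2 * N))) := by
    simp only [boundaryDist, h]
    ring
  rw [IsShort, hdiff, dist_stadiumVertex g h, abs_mul, abs_mul, abs_two,
    abs_of_pos (sin_pi_div_two_mul_pos hN)]
  gcongr

theorem abs_boundaryDist_sub_add_one_le (hg : 0 ≤ g) (hN : 0 < N) (p i : ℤ) :
    |boundaryDist g N p i - boundaryDist g N p (i + 1)| ≤
      2 * sin (π / (2 * N)) + g / 2 * |vertexSign N (i + 1) - vertexSign N i| := by
  have hstep : |(|(i : ℝ) - p| - |((i + 1 : ℤ) : ℝ) - p|)| ≤ 1 := by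
    refine (abs_abs_sub_abs_le _ _).trans_eq ?_
    push_cast
    norm_num
  have hsin := sin_pi_div_two_mul_pos hN
  calc |boundaryDist g N p i - boundaryDist g N p (i + 1)|
    _ = |(|(i : ℝ) - p| - |((i + 1 : ℤ) : ℝ) - p|) * (2 * sin (π / (2 * N))) +
          g / 2 * (vertexSign N (i + 1) - vertexSign N i)| := by
        simp only [boundaryDist]
        ring_nf
    _ ≤ |(|(i : ℝ) - p| - |((i + 1 : ℤ) : ℝ) - p|)| * (2 * sin (π / (2 * N))) +
          g / 2 * |vertexSign N (i + 1) - vertexSign N i| := by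
        refine (abs_add_le _ _).trans_eq ?_
        rw [abs_mul, abs_mul (g / 2), abs_of_nonneg (by positivity : 0 ≤ g / 2),
          abs_of_pos (by positivity : 0 < 2 * sin (π / (2 * N)))]
    _ ≤ _ := add_le_add (mul_le_of_le_one_left (by positivity) hstep) le_rfl

theorem isShort_add_one (hg : 0 ≤ g) (hN : 0 < N) (hi : -N ≤ i) (hiN : i + 1 < 2 * N) :
    IsShort g N p i (i + 1) := by
  have hbound := abs_boundaryDist_sub_add_one_le hg hN p i
  have hside (h : vertexSign N i = vertexSign N (i + 1)) : IsShort g N p i (i + 1) := by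
    refine hbound.trans_eq ?_
    rw [dist_stadiumVertex g h, h]
    push_cast
    rw [sub_add_cancel_left, neg_one_mul, sin_neg, abs_neg, abs_of_pos (sin_pi_div_two_mul_pos hN)]
    simp
  have hgap (h : dist (stadiumVertex g N i) (stadiumVertex g N (i + 1)) =
      2 * sin (π / (2 * N)) + g) (hs : |vertexSign N (i + 1) - vertexSign N i| ≤ 2) :
      IsShort g N p i (i + 1) := by
    rw [IsShort, h]
    nlinarith
  have hone := vertexSign_eq_one (i := 0) le_rfl hN
  have hneg := vertexSign_eq_neg_one (N := N) (i := -1) (by lia)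
  obtain h | rfl | h | rfl | h : i < -1 ∨ i = -1 ∨ 0 ≤ i ∧ i < N - 1 ∨ i = N - 1 ∨ N ≤ i := by lia
  · exact hside (by rw [vertexSign_eq_neg_one (by lia), vertexSign_eq_neg_one (by lia)])
  · refine hgap (dist_stadiumVertex_neg_one_zero hg hN) ?_
    norm_num [hone, hneg]
  · exact hside (by rw [vertexSign_eq_one (by lia) (by lia), vertexSign_eq_one (by lia) (by lia)])
  · refine hgap ?_ ?_
    · have hz := antiperiodic_stadiumVertex (g := g) hN
      rw [sub_eq_neg_add, hz, add_right_comm, hz, dist_neg_neg]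
      exact dist_stadiumVertex_neg_one_zero hg hN
    · rw [vertexSign_eq_neg_one (by lia), vertexSign_eq_one (by lia) (by lia)]
      norm_num
  · exact hside (by rw [vertexSign_eq_neg_one (by lia), vertexSign_eq_neg_one (by lia)])

theorem mul_le_sin_add_mul {c x y m M : ℝ} (hx : 0 ≤ x) (hy : 0 ≤ y) (hM : x + M * y ≤ π)
    (hm : 0 ≤ m) (hmM : m ≤ M) (h : M * c ≤ sin (x + M * y)) : m * c ≤ sin (x + m * y) := by
  rcases (hm.trans hmM).eq_or_lt with rfl | hM0
  · rwa [le_antisymm hmM hm]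
  have hMy : 0 ≤ M * y := by positivity
  have hw : m / M ≤ 1 := div_le_one_of_le₀ hmM hM0.le
  have hchord := strictConcaveOn_sin_Icc.concaveOn.2 (x := x) (y := x + M * y) ⟨hx, by linarith⟩
    ⟨by positivity, hM⟩ (sub_nonneg.2 hw) (by positivity) (sub_add_cancel 1 (m / M))
  simp only [smul_eq_mul] at hchord
  calc m * c = m / M * (M * c) := by field_simp
    _ ≤ m / M * sin (x + M * y) := by gcongr
    _ ≤ (1 - m / M) * sin x + m / M * sin (x + M * y) :=
        le_add_of_nonneg_left (mul_nonneg (sub_nonneg.2 hw)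
          (sin_nonneg_of_nonneg_of_le_pi hx (by linarith)))
    _ ≤ sin ((1 - m / M) * x + m / M * (x + M * y)) := hchord
    _ = sin (x + m * y) := by
        congr 1
        field_simp
        ring

theorem IsUpperDiagonal.mul_sin_le (h : IsUpperDiagonal N p l u) (hp : 0 ≤ p)
    (hcos : (N - 2 * p - 1) * sin (π / (2 * N)) ≤ cos (π / (2 * N))) :
    (l + u - 2 * p) * sin (π / (2 * N)) ≤ sin ((u - l) * (π / (2 * N))) := by
  obtain ⟨hl, hlu, hu, h⟩ := h
  have hsin := sin_pi_div_two_mul_pos (N := N) (by lia)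
  have hle := sin_le_sin_int_mul (N := N) (k := u - l) (by lia) (by lia)
  push_cast at hle
  rcases h with h | h | ⟨rfl, h⟩
  · have h : (l : ℝ) + u = 2 * p := by exact_mod_cast h
    rw [h, sub_self, zero_mul]
    linarith
  · have h : (l : ℝ) + u = 2 * p + 1 := by exact_mod_cast h
    rw [h, add_sub_cancel_left, one_mul]
    exact hle
  · have hN : (0 : ℝ) < N := by exact_mod_cast (by lia : 0 < N)
    have : (0 : ℝ) ≤ p := by exact_mod_cast hp
    have hu : (u : ℝ) + 1 ≤ N := by exact_mod_cast hu
    have h : (2 * p : ℝ) ≤ u := by exact_mod_cast h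
    have hπ : 2 * p * (π / (2 * N)) + (N - 2 * p - 1) * (π / (2 * N)) = π / 2 - π / (2 * N) := by
      field_simp
      ring
    have hh : 0 < π / (2 * N) := by positivity
    convert mul_le_sin_add_mul (c := sin (π / (2 * N))) (x := 2 * p * (π / (2 * N)))
      (y := π / (2 * N)) (m := u - 2 * p) (M := N - 2 * p - 1) (by positivity) (by positivity)
      (by linarith [pi_pos]) (by linarith) (by linarith)
      (by rwa [hπ, sin_pi_div_two_sub]) using 2
    · push_cast; ring
    · push_cast; ring

theorem IsUpperDiagonal.isShort (h : IsUpperDiagonal N p l u) (hp : 0 ≤ p)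
    (hcos : (N - 2 * p - 1) * sin (π / (2 * N)) ≤ cos (π / (2 * N))) : IsShort g N p l u := by
  have hsin := h.mul_sin_le hp hcos
  obtain ⟨hl, hlu, hu, h⟩ := h
  have hlp : (l : ℝ) ≤ p := by exact_mod_cast (by lia : l ≤ p)
  have hpu : (p : ℝ) ≤ u := by exact_mod_cast (by lia : p ≤ u)
  have hlup : (2 * p : ℝ) ≤ l + u := by exact_mod_cast (by lia : 2 * p ≤ l + u)
  refine isShort_of_vertexSign_eq ?_ ?_ (by lia)
  · rw [vertexSign_eq_one hl (by lia), vertexSign_eq_one (by lia) hu]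
  · have hswap : sin ((l - u) * (π / (2 * N))) = -sin ((u - l) * (π / (2 * N))) := by
      rw [← sin_neg]
      ring_nf
    rw [abs_of_nonpos (sub_nonpos.2 hlp), abs_of_nonneg (sub_nonneg.2 hpu),
      abs_of_nonpos (by linarith), hswap, abs_neg]
    refine le_trans (le_of_eq ?_) (hsin.trans (le_abs_self _))
    ring

theorem isShort_rectangle (hg : 0 ≤ g) (hp : 0 ≤ p) (hpN : 2 * p + 1 ≤ N)
    (hcos : (N - 2 * p - 1) * sin (π / (2 * N)) ≤ cos (π / (2 * N))) :
    IsShort g N p (-1) (N - 1) := by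
  have hN : 0 < N := by lia
  have hp' : (0 : ℝ) ≤ p := by exact_mod_cast hp
  have hpN' : 2 * (p : ℝ) + 1 ≤ N := by exact_mod_cast hpN
  have hsin := sin_pi_div_two_mul_pos hN
  have hdiff : boundaryDist g N p (-1) - boundaryDist g N p (N - 1) =
      g - (N - 2 * p - 2) * (2 * sin (π / (2 * N))) := by
    rw [boundaryDist, boundaryDist, vertexSign_eq_neg_one (by lia),
      vertexSign_eq_one (by lia) (by lia)]
    push_cast
    rw [abs_of_nonpos (by linarith), abs_of_nonneg (by linarith)]
    ring
  have hdist : dist (stadiumVertex g N (-1)) (stadiumVertex g N (N - 1)) ^ 2 =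
      4 + 4 * g * sin (π / (2 * N)) + g ^ 2 := by
    rw [sub_eq_neg_add, dist_stadiumVertex_antipode g hN, mul_pow, norm_stadiumVertex_sq g hN,
      abs_sin_vertexAngle_of_corner hN (by simp)]
    ring
  have htwo : 2 ≤ dist (stadiumVertex g N (-1)) (stadiumVertex g N (N - 1)) := by
    rw [← sq_le_sq₀ zero_le_two dist_nonneg, hdist]
    nlinarith [mul_nonneg hg hsin.le]
  have hside : 2 * sin (π / (2 * N)) + g ≤
      dist (stadiumVertex g N (-1)) (stadiumVertex g N (N - 1)) := by
    rw [← sq_le_sq₀ (by positivity) dist_nonneg, hdist]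
    nlinarith [sin_sq_le_one (π / (2 * N))]
  have hcos_le := cos_le_one (π / (2 * N))
  rw [IsShort, hdiff, abs_le]
  constructor
  · linarith
  · nlinarith

theorem isShort_of_isDiagonal (hg : 0 ≤ g) (hp : 0 ≤ p) (hpN : 2 * p + 1 ≤ N)
    (hcos : (N - 2 * p - 1) * sin (π / (2 * N)) ≤ cos (π / (2 * N))) (h : IsDiagonal N p l u) :
    IsShort g N p l u := by
  rcases h with h | ⟨rfl, rfl⟩ | h
  · exact h.isShort hp hcos
  · exact isShort_rectangle hg hp hpN hcos
  · have hS := h.isShort (g := g) hp hcos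
    unfold IsUpperDiagonal at h
    exact hS.antipode (by lia) (by lia) (by lia) (by lia) (by lia)

theorem exists_sphere_of_isLadderTriangle (hg : 0 ≤ g) (hp : 0 ≤ p) (hpN : 2 * p + 1 ≤ N)
    (hN : 2 ≤ N) (hT : IsLadderTriangle (IsDiagonal N p) i j k) :
    ∃ S : EuclideanGeometry.Sphere Plane, stadiumVertex g N i ∈ S ∧ stadiumVertex g N j ∈ S ∧
      stadiumVertex g N k ∈ S ∧ ∀ m, S.radius ≤ dist (stadiumVertex g N m) S.center := by
  have hN' : 0 < N := by lia
  rcases hT.half_or_corner hp hpN hN with ⟨hi, hij, hjk, hk⟩ | h | h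
  · have hone (m : ℤ) (him : i ≤ m) (hmk : m ≤ k) : vertexSign N m = 1 :=
      vertexSign_eq_one (by lia) (by lia)
    apply exists_sphere_of_vertexSign_eq hg hN' <;>
      rw [hone i le_rfl (by lia), hone _ (by lia) (by lia)]
  · have hneg (m : ℤ) (hm : m = i ∨ m = j ∨ m = k) := vertexSign_eq_neg_one (h m hm)
    apply exists_sphere_of_vertexSign_eq hg hN' <;> rw [hneg _ (by simp), hneg _ (by simp)]
  · exact exists_sphere_of_corner hg hN' (by simpa using h i (by simp))
      (by simpa using h j (by simp)) (by simpa using h k (by simp))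

theorem exists_isDelaunayTriangulation_le_dilation (hg : 0 ≤ g) (hp : 0 ≤ p) (hpN : 2 * p + 1 ≤ N)
    (hN : 2 ≤ N) (hcos : (N - 2 * p - 1) * sin (π / (2 * N)) ≤ cos (π / (2 * N))) {r : ℝ}
    (hr : 0 ≤ r)
    (hratio : r * (2 * ‖stadiumVertex g N p‖) ≤ N * (2 * sin (π / (2 * N))) + g) :
    ∃ (P : Finset Plane) (K : SimplicialComplex ℝ Plane), InConvexPosition P ∧
      IsDelaunayTriangulation P K ∧ ENNReal.ofReal r ≤ dilation (edgeGraph P K) := by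
  have hN' : 0 < N := by lia
  refine (isLadder_isDiagonal hp hpN hN).exists_le_dilation (h := boundaryDist g N p)
    (isConvexPolygon_stadiumVertex hg hN') (by lia) (isDiagonal_final hp hpN hN)
    (fun i j k => exists_sphere_of_isLadderTriangle hg hp hpN hN)
    (fun i hi hi' => isShort_add_one hg hN' (by lia) (by lia))
    (fun i k => isShort_of_isDiagonal hg hp hpN hcos) (p := p) (q := p + N) ?_ ?_ ?_ hr ?_
  · rw [Finset.mem_Icc]; lia
  · rw [Finset.mem_Icc]; lia
  · lia
  have hantipode := boundaryDist_add_boundaryDist (g := g) hN' (by lia : p - N ≤ p) le_rfl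
  rw [boundaryDist_self hp (by lia), zero_add] at hantipode
  rwa [dist_stadiumVertex_antipode g hN', boundaryDist_self hp (by lia), sub_zero, hantipode]

end Shortness

section Numerics

theorem cos_two_mul_le {x c : ℝ} (hx : |x| ≤ 1) (h : cos x ≤ c) : cos (2 * x) ≤ 2 * c ^ 2 - 1 := by
  have := (cos_pos_of_le_one hx).le
  rw [cos_two_mul]
  gcongr

theorem cos_le_of_mem_Icc {x : ℝ} (hx : x ∈ Set.Icc 0.99996 1) : cos x ≤ 0.5404 := by
  have h0 : cos 0.0624975 ≤ 0.998047826 := by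
    have := sub_le_iff_le_add.1 (abs_sub_le_iff.1 (cos_bound (x := 0.0624975) (by norm_num))).1
    norm_num at this ⊢
    linarith
  have h1 : cos 0.124995 ≤ 0.992198926 := by
    have := cos_two_mul_le (by norm_num) h0
    norm_num at this ⊢
    linarith
  have h2 : cos 0.24999 ≤ 0.968917418 := by
    have := cos_two_mul_le (by norm_num) h1
    norm_num at this ⊢
    linarith
  have h3 : cos 0.49998 ≤ 0.877601926 := by
    have := cos_two_mul_le (by norm_num) h2
    norm_num at this ⊢
    linarith
  calc cos x ≤ cos 0.99996 :=
        cos_le_cos_of_nonneg_of_le_pi (by norm_num) (by linarith [hx.2, pi_gt_three]) hx.1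
    _ ≤ 0.5404 := by
        have := cos_two_mul_le (by norm_num) h3
        norm_num at this ⊢
        linarith

theorem sin_vertexAngle_le : sin (vertexAngle 5000 908) ≤ 0.5404 := by
  have hangle : vertexAngle 5000 908 = π / 2 - 3183 * (π / 10000) := by
    norm_num [vertexAngle]
    ring
  rw [hangle, sin_pi_div_two_sub]
  refine cos_le_of_mem_Icc ⟨?_, ?_⟩ <;> linarith [pi_gt_d6, pi_lt_d6]

theorem norm_stadiumVertex_le : 2 * ‖stadiumVertex 0.3 5000 908‖ ≤ 2.176806 := by
  have hsq := norm_stadiumVertex_sq 0.3 (N := 5000) (by norm_num) 908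
  rw [abs_of_pos (sin_vertexAngle_pos (by norm_num) (by norm_num))] at hsq
  nlinarith [sin_vertexAngle_le, norm_nonneg (stadiumVertex 0.3 5000 908)]

theorem le_mul_sin : 3.14159 ≤ 5000 * (2 * sin (π / (2 * 5000))) := by
  have hsin := sin_gt_sub_cube (x := π / 10000) (by positivity)
  have hcube : (π / 10000) ^ 3 ≤ (4 / 10000) ^ 3 := by gcongr; exact pi_le_four
  norm_num at hsin hcube ⊢
  linarith [pi_gt_d6]

theorem mul_sin_le_cos : 3183 * sin (π / (2 * 5000)) ≤ cos (π / (2 * 5000)) := by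
  have hsin := sin_le (x := π / (2 * 5000)) (by positivity)
  have hcos := one_sub_sq_div_two_le_cos (x := π / (2 * 5000))
  nlinarith [pi_lt_d6, pi_pos]

end Numerics

end DelaunayDilation

theorem theorem1 :
    ∃ (P : Finset DelaunayDilation.Plane)
      (K : Geometry.SimplicialComplex ℝ DelaunayDilation.Plane),
      DelaunayDilation.InConvexPosition P ∧
      DelaunayDilation.IsDelaunayTriangulation P K ∧
      ENNReal.ofReal 1.5810 ≤ DelaunayDilation.dilation (DelaunayDilation.edgeGraph P K) := by
  have hcos := DelaunayDilation.mul_sin_le_cos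
  have hperimeter := DelaunayDilation.le_mul_sin
  have hdiameter := DelaunayDilation.norm_stadiumVertex_le
  refine DelaunayDilation.exists_isDelaunayTriangulation_le_dilation (g := 0.3) (N := 5000)
    (p := 908) (by norm_num) (by norm_num) (by norm_num) (by norm_num) ?_ (by norm_num) ?_
  · push_cast
    norm_num at hcos ⊢
    exact hcos
  · push_cast
    norm_num at hperimeter hdiameter ⊢
    linarith
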